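/- Conventions. All spaces are real Hilbert spaces. A set-valued operator $A\colon X\rightrightarrows X$ assigns to each $x\in X$ a set $Ax\subseteq X$; $\operatorname{dom}A=\{x: Ax\neq\varnothing\}$, $\operatorname{gra}A=\{(x,x^*): x^*\in Ax\}$. $A$ is monotone if $\langle x-y,x^*-y^*\rangle\ge 0$ for all $(x,x^*),(y,y^*)\in\operatorname{gra}A$; $B$ extends $A$ if $\operatorname{gra}A\subseteq\operatorname{gra}B$; a monotone operator is maximal monotone if it has no proper monotone extension. $\operatorname{ri}$ is the relative interior, and for a set $D$, $N_D(x)=\{x^*: \langle d-x,x^*\rangle\le 0\ \forall d\in D\}$ if $x\in D$ and $N_D(x)=\varnothing$ otherwise. For a monotone operator $A$ with nonempty graph on a real Hilbert space $H$, put $$\Phi_A(x,x^*)=\sup_{(a,a^*)\in\operatorname{gra}A}\big(\langle x,a^*\rangle+\langle a,x^*\rangle-\langle a,a^*\rangle\big),\qquad \Phi_A^*(y^*,y)=\sup_{(x,x^*)\in H\times H}\big(\langle x,y^*\rangle+\langle y,x^*\rangle-\Phi_A(x,x^*)\big),$$ $$\Psi_A(x,x^*)=\inf_{(x,x^*)=\frac12(y+z,\,y^*+z^*)}\Big(\tfrac12\Phi_A(y,y^*)+\tfrac12\Phi_A^*(z^*,z)+\tfrac18\big(\|y-z\|^2+\|y^*-z^*\|^2\big)\Big),$$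 and define $\widetilde A\colon H\rightrightarrows H$ by $x^*\in\widetilde A x\Leftrightarrow (x^*,x)\in\partial\Psi_A(x,x^*)$, where $\partial$ is the subdifferential of convex analysis. **Theorem 2.15.** Let $X$ be a finite-dimensional real Hilbert space and let $A\colon X\rightrightarrows X$ be monotone with $0\in\operatorname{ri}\operatorname{conv}\operatorname{dom}A$. Set $D:=\overline{\operatorname{conv}}\operatorname{dom}A$ and $Y:=\operatorname{span}\operatorname{dom}A$, let $P\colon X\to X$ be the orthogonal projector onto $Y$, and let $Q\colon X\to Y$, $x\mapsto Px$. Then $\operatorname{ri}D=\operatorname{ri}\operatorname{conv}\operatorname{dom}A$, $0\in\operatorname{int}_Y D$, $\operatorname{aff}\operatorname{dom}A=Y$, $Y$ is closed, $P^*=P$, and $Q^*\colon Y\to X$ is the inclusion $y\mapsto y$. Moreover: 1. The composition $PA\colon Y\rightrightarrows Y$, $y\mapsto P(Ay)$, is monotone. 2. If $B\colon Y\rightrightarrows Y$ is any maximal monotone extension of $PA$ (for example $B=\widetilde{PA}$, formed in $H=Y$, which is such an extension), then $\widehat B:=Q^*BQ+N_D\colon X\rightrightarrows X$ is a maximal monotone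 extension of $A$, and $\overline{\operatorname{dom}}\,\widehat B=D$. -/

import Mathlib

open scoped Pointwise InnerProductSpace

/-- The domain of a set-valued operator `A : E ⇉ F`. -/
def opDom {E F : Type*} (A : E → Set F) : Set E := {x | (A x).Nonempty}

/-- `B` is an extension of `A`: the graph of `A` is contained in the graph of `B`. -/
def IsExtension {E F : Type*} (B A : E → Set F) : Prop := ∀ x, A x ⊆ B x

section Operators

variable {E : Type*} [NormedAddCommGroup E] [InnerProductSpace ℝ E]

/-- Monotonicity of a set-valued operator on a real inner product space. -/
def IsMonotoneOp (A : E → Set E) : Prop :=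
  ∀ x, ∀ u ∈ A x, ∀ y, ∀ v ∈ A y, 0 ≤ ⟪x - y, u - v⟫_ℝ

/-- A monotone operator is maximal monotone if it has no proper monotone extension. -/
def IsMaximalMonotoneOp (A : E → Set E) : Prop :=
  IsMonotoneOp A ∧ ∀ B : E → Set E, IsMonotoneOp B → IsExtension B A → B = A

/-- The normal cone operator of `D`; its value is empty outside `D`. -/
def normalConeOp (D : Set E) : E → Set E :=
  fun x => {u | x ∈ D ∧ ∀ d ∈ D, ⟪d - x, u⟫_ℝ ≤ 0}

/-- The Fitzpatrick function `Φ_A (x, x*)`, with values in the extended reals. -/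
noncomputable def fitzpatrick (A : E → Set E) (p : E × E) : EReal :=
  ⨆ (a : E) (u : E) (_ : u ∈ A a), ((⟪p.1, u⟫_ℝ + ⟪a, p.2⟫_ℝ - ⟪a, u⟫_ℝ : ℝ) : EReal)

/-- The Fenchel conjugate of a function on `E × E` for the pairing
`⟨(x, x*), (y*, y)⟩ = ⟨x, y*⟩ + ⟨x*, y⟩`; the argument is `q = (y*, y)`. -/
noncomputable def fenchelConj (f : E × E → EReal) (q : E × E) : EReal :=
  ⨆ p : E × E, ((⟪p.1, q.1⟫_ℝ + ⟪p.2, q.2⟫_ℝ : ℝ) : EReal) - f p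

/-- The proximal average `Ψ_A` of the Fitzpatrick function `Φ_A` and of the transpose of its
conjugate: at `p = (x, x*)`, the infimum over all `y = (y, y*)`, `z = (z, z*)` with midpoint `p`. -/
noncomputable def proxAverage (A : E → Set E) (p : E × E) : EReal :=
  ⨅ (y : E × E) (z : E × E) (_ : p = (1 / 2 : ℝ) • (y + z)),
    ((1 / 2 : ℝ) : EReal) * fitzpatrick A y
      + ((1 / 2 : ℝ) : EReal) * fenchelConj (fitzpatrick A) (z.2, z.1)
      + (((1 / 8 : ℝ) * (‖y.1 - z.1‖ ^ 2 + ‖y.2 - z.2‖ ^ 2) : ℝ) : EReal)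

/-- The subdifferential of convex analysis for an extended-real-valued function on the Hilbert
product `E × E`, at points where the function is finite (and empty elsewhere). -/
def subdiff (f : E × E → EReal) (p : E × E) : Set (E × E) :=
  {g | f p ≠ ⊤ ∧ f p ≠ ⊥ ∧
    ∀ q : E × E, f p + ((⟪q.1 - p.1, g.1⟫_ℝ + ⟪q.2 - p.2, g.2⟫_ℝ : ℝ) : EReal) ≤ f q}

/-- The operator `Ã` built from `A` by the proximal average:
`x* ∈ Ã x` if and only if `(x*, x) ∈ ∂Ψ_A (x, x*)`. -/
def proxExtension (A : E → Set E) : E → Set E :=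
  fun x => {u | (u, x) ∈ subdiff (proxAverage A) (x, u)}

end Operators

section Compositions

variable {X : Type*} [NormedAddCommGroup X] [InnerProductSpace ℝ X]

/-- For a subspace `Y` of `X` and a linear map `Q : X → Y`, the operator `y ↦ Q (A y)` on `Y`. -/
def compressOp {Y : Submodule ℝ X} (Q : X →ₗ[ℝ] Y) (A : X → Set X) : Y → Set Y :=
  fun y => Q '' A (y : X)

/-- The operator `Q* B Q + N_D : X ⇉ X`, where `Q* : Y → X` is the adjoint of `Q`. -/
noncomputable def liftOp [FiniteDimensional ℝ X] {Y : Submodule ℝ X} (Q : X →ₗ[ℝ] Y)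
    (B : Y → Set Y) (D : Set X) : X → Set X :=
  fun x => LinearMap.adjoint Q '' B (Q x) + normalConeOp D x

end Compositions

/-! ### The Fitzpatrick function, its proximal average, and the resulting maximal extension -/

section ProximalAverage

variable {E : Type*} [NormedAddCommGroup E] [InnerProductSpace ℝ E]

/-! Everything is done in `Y`, where `D` has interior, and then carried to `X`. For `x` in `D ⊆ Y`,
the space `Yᗮ` lies in the normal cone of `D` at `x`. Hence `u = Q u + (u - Q u)` shows that the
lift extends `A`, and solving `x + u + w = Q z` in `Y` and adding `z - Q z` to `w` solves the lifted
equation for `z`. Surjectivity of identity plus operator then gives maximality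
(`isMaximalMonotoneOp_of_surjective`).

The equation in `Y` is solved by `IsMaximalMonotoneOp.exists_add_normalConeOp_eq`: the normal cone
is replaced by its Yosida regularisation, and `0 ∈ dom B ∩ int D` bounds the approximate solutions.
That `0 ∈ dom B`, and that the closure of the lifted domain fills `D`, both follow from
`IsMaximalMonotoneOp.interior_convexHull_subset_opDom`.

Minty's theorem underlies both results. It comes from the proximal average: the proximal point of
`Ψ_A` at `(v, v)` is the midpoint of those of `Φ_A` and its transposed conjugate, which splits `v`
as `x + u` with `u ∈ Ã x` (`exists_mem_proxExtension_add`). -/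

theorem norm_add_smul_sq (v d : E) (t : ℝ) :
    ‖v + t • d‖ ^ 2 = ‖v‖ ^ 2 + 2 * t * ⟪d, v⟫_ℝ + t ^ 2 * ‖d‖ ^ 2 := by
  rw [norm_add_sq_real, norm_smul, mul_pow, Real.norm_eq_abs, sq_abs, inner_smul_right,
    real_inner_comm]
  ring

theorem le_fitzpatrick {A : E → Set E} {a u : E} (hu : u ∈ A a) (p : E × E) :
    ((⟪p.1, u⟫_ℝ + ⟪a, p.2⟫_ℝ - ⟪a, u⟫_ℝ : ℝ) : EReal) ≤ fitzpatrick A p := by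
  unfold fitzpatrick
  exact le_iSup_of_le a (le_iSup_of_le u (le_iSup_of_le hu le_rfl))

theorem fitzpatrick_le_coe {A : E → Set E} {p : E × E} {c : ℝ} :
    fitzpatrick A p ≤ c ↔ ∀ a, ∀ u ∈ A a, ⟪p.1, u⟫_ℝ + ⟪a, p.2⟫_ℝ - ⟪a, u⟫_ℝ ≤ c := by
  simp only [fitzpatrick, iSup_le_iff, EReal.coe_le_coe_iff]

theorem fitzpatrick_of_mem {A : E → Set E} (hA : IsMonotoneOp A) {a u : E} (hu : u ∈ A a) :
    fitzpatrick A (a, u) = (⟪a, u⟫_ℝ : ℝ) := by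
  apply le_antisymm
  · rw [fitzpatrick_le_coe]
    intro b v hv
    have := hA a u hu b v hv
    simp only [inner_sub_left, inner_sub_right] at this ⊢
    linarith
  · simpa using le_fitzpatrick hu (a, u)

theorem le_fenchelConj (f : E × E → EReal) (p q : E × E) {c : ℝ} (hp : f p = c) :
    ((⟪p.1, q.1⟫_ℝ + ⟪p.2, q.2⟫_ℝ - c : ℝ) : EReal) ≤ fenchelConj f q := by
  unfold fenchelConj
  refine le_iSup_of_le p ?_
  rw [hp, EReal.coe_sub]

theorem fenchelConj_le_of_subgradient {f : E × E → EReal} {p g : E × E} {c : ℝ}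
    (h : ∀ q : E × E,
      ((c + (⟪q.1 - p.1, g.1⟫_ℝ + ⟪q.2 - p.2, g.2⟫_ℝ) : ℝ) : EReal) ≤ f q) :
    fenchelConj f g ≤ ((⟪p.1, g.1⟫_ℝ + ⟪p.2, g.2⟫_ℝ - c : ℝ) : EReal) := by
  unfold fenchelConj
  refine iSup_le fun q => ?_
  calc _ ≤ ((⟪q.1, g.1⟫_ℝ + ⟪q.2, g.2⟫_ℝ : ℝ) : EReal) -
        ((c + (⟪q.1 - p.1, g.1⟫_ℝ + ⟪q.2 - p.2, g.2⟫_ℝ) : ℝ) : EReal) :=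
        EReal.sub_le_sub le_rfl (h q)
    _ ≤ _ := by
        rw [← EReal.coe_sub, EReal.coe_le_coe_iff]
        simp only [inner_sub_left]
        linarith

/-- On the graph `Φ_A` equals the duality product, so every affine function in the supremum defining
`Φ_A` also occurs in the one defining the transposed conjugate. -/
theorem fitzpatrick_le_fenchelConj_swap {A : E → Set E} (hA : IsMonotoneOp A) (q : E × E) :
    fitzpatrick A q ≤ fenchelConj (fitzpatrick A) (q.2, q.1) := by
  conv_lhs => unfold fitzpatrick
  refine iSup_le fun a => iSup_le fun u => iSup_le fun hu => ?_
  refine le_trans (le_of_eq ?_) (le_fenchelConj _ (a, u) (q.2, q.1) (fitzpatrick_of_mem hA hu))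
  rw [real_inner_comm q.1 u]
  congr 1
  simp only
  ring

/-- Lower bounds on the two functions averaged by the proximal average give a lower bound on it. -/
theorem le_proxAverage {A : E → Set E} {φ γ : E × E → ℝ}
    (hφ : ∀ y, (φ y : EReal) ≤ fitzpatrick A y)
    (hγ : ∀ z : E × E, (γ z : EReal) ≤ fenchelConj (fitzpatrick A) (z.2, z.1)) {q : E × E} {c : ℝ}
    (h : ∀ y z : E × E, q = (1 / 2 : ℝ) • (y + z) → c ≤ 1 / 2 * φ y + 1 / 2 * γ z
      + 1 / 8 * (‖y.1 - z.1‖ ^ 2 + ‖y.2 - z.2‖ ^ 2)) :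
    (c : EReal) ≤ proxAverage A q := by
  unfold proxAverage
  refine le_iInf fun y => le_iInf fun z => le_iInf fun hq => ?_
  refine (EReal.coe_le_coe_iff.2 (h y z hq)).trans ?_
  rw [EReal.coe_add, EReal.coe_add, EReal.coe_mul, EReal.coe_mul]
  have h2 : (0 : EReal) ≤ ((1 / 2 : ℝ) : EReal) := by exact_mod_cast (by norm_num)
  exact add_le_add (add_le_add (mul_le_mul_of_nonneg_left (hφ y) h2)
    (mul_le_mul_of_nonneg_left (hγ z) h2)) le_rfl

theorem proxAverage_le {A : E → Set E} {y z q : E × E} {b c d : ℝ}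
    (hy : fitzpatrick A y ≤ b) (hz : fenchelConj (fitzpatrick A) (z.2, z.1) ≤ c)
    (hq : q = (1 / 2 : ℝ) • (y + z))
    (h : 1 / 2 * b + 1 / 2 * c + 1 / 8 * (‖y.1 - z.1‖ ^ 2 + ‖y.2 - z.2‖ ^ 2) ≤ d) :
    proxAverage A q ≤ d := by
  unfold proxAverage
  refine (iInf_le_of_le y (iInf_le_of_le z (iInf_le_of_le hq le_rfl))).trans ?_
  refine le_trans ?_ (EReal.coe_le_coe_iff.2 h)
  rw [EReal.coe_add, EReal.coe_add, EReal.coe_mul, EReal.coe_mul]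
  have h2 : (0 : EReal) ≤ ((1 / 2 : ℝ) : EReal) := by exact_mod_cast (by norm_num)
  exact add_le_add (add_le_add (mul_le_mul_of_nonneg_left hy h2)
    (mul_le_mul_of_nonneg_left hz h2)) le_rfl

theorem mem_subdiff_of_le {f : E × E → EReal} {p g : E × E} {c : ℝ} (hp : f p ≤ c)
    (h : ∀ q : E × E,
      ((c + (⟪q.1 - p.1, g.1⟫_ℝ + ⟪q.2 - p.2, g.2⟫_ℝ) : ℝ) : EReal) ≤ f q) :
    g ∈ subdiff f p := by
  have hc : f p = c := le_antisymm hp (by simpa using h p)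
  refine ⟨by simp [hc], by simp [hc], fun q => ?_⟩
  rw [hc, ← EReal.coe_add]
  exact h q

/-- Adding the subgradient inequalities at the two points cancels the finite values of `Ψ_A` and
leaves twice the monotonicity inequality. -/
theorem isMonotoneOp_proxExtension (A : E → Set E) : IsMonotoneOp (proxExtension A) := by
  rintro x u ⟨h1, h2, h3⟩ y v ⟨k1, k2, k3⟩
  have e1 := h3 (y, v)
  have e2 := k3 (x, u)
  lift proxAverage A (x, u) to ℝ using ⟨h1, h2⟩ with c
  lift proxAverage A (y, v) to ℝ using ⟨k1, k2⟩ with d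
  rw [← EReal.coe_add, EReal.coe_le_coe_iff] at e1 e2
  simp only [inner_sub_left, inner_sub_right] at e1 e2 ⊢
  linarith [real_inner_comm x u, real_inner_comm x v, real_inner_comm y u, real_inner_comm y v]

/-- The affine function attached to a graph point minorises both averaged functions, hence `Ψ_A`;
the choice `y = z = (a, u)` in the infimum shows that it touches `Ψ_A` there. -/
theorem isExtension_proxExtension {A : E → Set E} (hA : IsMonotoneOp A) :
    IsExtension (proxExtension A) A := by
  intro a u hu
  refine mem_subdiff_of_le (c := ⟪a, u⟫_ℝ) ?_ fun q => ?_
  · refine proxAverage_le (y := (a, u)) (z := (a, u)) (fitzpatrick_of_mem hA hu).le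
      (fenchelConj_le_of_subgradient (p := (a, u)) (g := (u, a)) (c := ⟪a, u⟫_ℝ) fun q => ?_) ?_ ?_
    · refine le_trans (EReal.coe_le_coe_iff.2 (le_of_eq ?_)) (le_fitzpatrick hu q)
      simp only [inner_sub_left]
      linarith [real_inner_comm a u, real_inner_comm a q.2]
    · rw [← two_smul ℝ, smul_smul]; norm_num
    · simp only [sub_self, norm_zero]
      linarith [real_inner_comm a u]
  · refine le_proxAverage (le_fitzpatrick hu)
      (fun z => (le_fitzpatrick hu z).trans (fitzpatrick_le_fenchelConj_swap hA z)) ?_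
    rintro y z rfl
    simp only [Prod.smul_fst, Prod.smul_snd, Prod.fst_add, Prod.snd_add, inner_sub_left,
      inner_smul_left, inner_add_left, conj_trivial]
    have := sq_nonneg ‖y.1 - z.1‖
    have := sq_nonneg ‖y.2 - z.2‖
    linarith [real_inner_comm a u, real_inner_comm a y.2, real_inner_comm a z.2]

theorem isClosed_fitzpatrick_epigraph (A : E → Set E) :
    IsClosed {x : (E × E) × ℝ |
      ∀ a, ∀ u ∈ A a, ⟪x.1.1, u⟫_ℝ + ⟪a, x.1.2⟫_ℝ - ⟪a, u⟫_ℝ ≤ x.2} := by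
  simp only [Set.ofPred_forall]
  refine isClosed_iInter fun a => isClosed_iInter fun u => isClosed_iInter fun _ => ?_
  exact isClosed_le (by fun_prop) (by fun_prop)

/-- The regularised Fitzpatrick function attains its minimum, stated on its epigraph. -/
theorem exists_min_fitzpatrick [FiniteDimensional ℝ E] {A : E → Set E} (hA : IsMonotoneOp A)
    {a₀ u₀ : E} (h₀ : u₀ ∈ A a₀) (w : E × E) :
    ∃ (y : E × E) (c : ℝ), fitzpatrick A y ≤ c ∧ ∀ (q : E × E) (d : ℝ), fitzpatrick A q ≤ d →
      c + 1 / 2 * (‖y.1 - w.1‖ ^ 2 + ‖y.2 - w.2‖ ^ 2)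
        ≤ d + 1 / 2 * (‖q.1 - w.1‖ ^ 2 + ‖q.2 - w.2‖ ^ 2) := by
  set S : Set ((E × E) × ℝ) := {x | ∀ a, ∀ u ∈ A a,
    ⟪x.1.1, u⟫_ℝ + ⟪a, x.1.2⟫_ℝ - ⟪a, u⟫_ℝ ≤ x.2} with hS
  set f : (E × E) × ℝ → ℝ :=
    fun x => x.2 + 1 / 2 * (‖x.1.1 - w.1‖ ^ 2 + ‖x.1.2 - w.2‖ ^ 2) with hf
  have hfc : Continuous f := by fun_prop
  set x₀ : (E × E) × ℝ := ((a₀, u₀), ⟪a₀, u₀⟫_ℝ) with hx₀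
  have hx₀S : x₀ ∈ S := fitzpatrick_le_coe.1 (fitzpatrick_of_mem hA h₀).le
  set K := S ∩ {x | f x ≤ f x₀} with hK
  have hKc : IsClosed K :=
    (isClosed_fitzpatrick_epigraph A).inter (isClosed_le hfc continuous_const)
  -- Coercivity: the affine minorant from `(a₀, u₀)` plus the quadratic term is a square centred at
  -- `(w.1 - u₀, w.2 - a₀)`; `M` is what completing the square leaves.
  obtain ⟨M, hM⟩ : ∃ M : ℝ, M = 2 * (f x₀ + ⟪a₀, u₀⟫_ℝ - ⟪w.1, u₀⟫_ℝ - ⟪w.2, a₀⟫_ℝ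
    + 1 / 2 * ‖u₀‖ ^ 2 + 1 / 2 * ‖a₀‖ ^ 2) := ⟨_, rfl⟩
  have key : ∀ x ∈ K, ‖x.1.1 - (w.1 - u₀)‖ ^ 2 + ‖x.1.2 - (w.2 - a₀)‖ ^ 2 ≤ M := by
    rintro x ⟨hxS, hxf⟩
    have h1 := hxS a₀ u₀ h₀
    have h2 : x.2 + 1 / 2 * (‖x.1.1 - w.1‖ ^ 2 + ‖x.1.2 - w.2‖ ^ 2) ≤ f x₀ := hxf
    have e1 : ‖x.1.1 - (w.1 - u₀)‖ ^ 2
        = ‖x.1.1 - w.1‖ ^ 2 + 2 * (⟪x.1.1, u₀⟫_ℝ - ⟪w.1, u₀⟫_ℝ) + ‖u₀‖ ^ 2 := by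
      rw [← sub_add, norm_add_sq_real, inner_sub_left]
    have e2 : ‖x.1.2 - (w.2 - a₀)‖ ^ 2
        = ‖x.1.2 - w.2‖ ^ 2 + 2 * (⟪x.1.2, a₀⟫_ℝ - ⟪w.2, a₀⟫_ℝ) + ‖a₀‖ ^ 2 := by
      rw [← sub_add, norm_add_sq_real, inner_sub_left]
    rw [e1, e2, hM]
    linarith [real_inner_comm a₀ x.1.2]
  set C : Set (E × E) :=
    Metric.closedBall (w.1 - u₀) (Real.sqrt M) ×ˢ Metric.closedBall (w.2 - a₀) (Real.sqrt M) with hC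
  have hCc : IsCompact C :=
    (isCompact_closedBall (w.1 - u₀) _).prod (isCompact_closedBall (w.2 - a₀) _)
  have hKC : ∀ x ∈ K, x.1 ∈ C := by
    intro x hx
    have := key x hx
    refine ⟨?_, ?_⟩ <;> rw [Metric.mem_closedBall, dist_eq_norm] <;> apply Real.le_sqrt_of_sq_le
    · linarith [sq_nonneg ‖x.1.2 - (w.2 - a₀)‖]
    · linarith [sq_nonneg ‖x.1.1 - (w.1 - u₀)‖]
  obtain ⟨m, hm⟩ := hCc.bddBelow_image (f := fun p : E × E => ⟪p.1, u₀⟫_ℝ + ⟪a₀, p.2⟫_ℝ - ⟪a₀, u₀⟫_ℝ)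
    (by fun_prop)
  have hKcomp : IsCompact K := by
    refine (hCc.prod (isCompact_Icc (a := m) (b := f x₀))).of_isClosed_subset hKc fun x hx => ?_
    refine ⟨hKC x hx, (hm ⟨x.1, hKC x hx, rfl⟩).trans (hx.1 a₀ u₀ h₀), ?_⟩
    have h2 : x.2 + 1 / 2 * (‖x.1.1 - w.1‖ ^ 2 + ‖x.1.2 - w.2‖ ^ 2) ≤ f x₀ := hx.2
    linarith [sq_nonneg ‖x.1.1 - w.1‖, sq_nonneg ‖x.1.2 - w.2‖]
  have hx₀K : x₀ ∈ K := ⟨hx₀S, le_refl (f x₀)⟩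
  obtain ⟨x, hxK, hx⟩ := hKcomp.exists_isMinOn ⟨x₀, hx₀K⟩ hfc.continuousOn
  refine ⟨x.1, x.2, fitzpatrick_le_coe.2 hxK.1, fun q d hq => ?_⟩
  by_cases hqf : f (q, d) ≤ f x₀
  · exact hx (show (q, d) ∈ K from ⟨fitzpatrick_le_coe.1 hq, hqf⟩)
  · exact (hx hx₀K).trans (not_le.1 hqf).le

/-- Proximal points of the Fitzpatrick function. -/
theorem exists_prox_fitzpatrick [FiniteDimensional ℝ E] {A : E → Set E} (hA : IsMonotoneOp A)
    {a₀ u₀ : E} (h₀ : u₀ ∈ A a₀) (w : E × E) :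
    ∃ (y : E × E) (c : ℝ), fitzpatrick A y = c ∧ ∀ q : E × E,
      ((c + (⟪q.1 - y.1, w.1 - y.1⟫_ℝ + ⟪q.2 - y.2, w.2 - y.2⟫_ℝ) : ℝ) : EReal)
        ≤ fitzpatrick A q := by
  obtain ⟨y, c, hy, hmin⟩ := exists_min_fitzpatrick hA h₀ w
  have key : ∀ q : E × E,
      ((c + (⟪q.1 - y.1, w.1 - y.1⟫_ℝ + ⟪q.2 - y.2, w.2 - y.2⟫_ℝ) : ℝ) : EReal)
        ≤ fitzpatrick A q := by
    intro q
    rw [← not_lt]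
    intro hlt
    obtain ⟨d, hqd, hd⟩ := EReal.lt_iff_exists_real_btwn.1 hlt
    rw [EReal.coe_lt_coe_iff] at hd
    have hqd := hqd.le
    obtain ⟨N, hN⟩ : ∃ N : ℝ, N = ‖q.1 - y.1‖ ^ 2 + ‖q.2 - y.2‖ ^ 2 := ⟨_, rfl⟩
    have hN0 : 0 ≤ N := by rw [hN]; positivity
    obtain ⟨s, hs⟩ : ∃ s : ℝ,
      s = c + (⟪q.1 - y.1, w.1 - y.1⟫_ℝ + ⟪q.2 - y.2, w.2 - y.2⟫_ℝ) - d := ⟨_, rfl⟩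
    have hs0 : 0 < s := by linarith
    -- If the subgradient inequality fails at `q` by `s`, moving from `y` towards `q` by `t` changes
    -- the objective by at most `t * (-s + t * N / 2)`. This `t` gives `t * N ≤ s`, contradicting
    -- minimality.
    obtain ⟨t, ht⟩ : ∃ t : ℝ, t = s / (s + N) := ⟨_, rfl⟩
    have ht0 : 0 < t := by rw [ht]; positivity
    have htN : t * (s + N) = s := by rw [ht]; field_simp
    have ht1 : t ≤ 1 := by rw [ht, div_le_one (by linarith)]; linarith
    have h1 : fitzpatrick A (y + t • (q - y)) ≤ ((c + t * (d - c) : ℝ) : EReal) := by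
      rw [fitzpatrick_le_coe] at hy hqd ⊢
      intro a u hu
      have e1 := mul_le_mul_of_nonneg_left (hy a u hu) (sub_nonneg.2 ht1)
      have e2 := mul_le_mul_of_nonneg_left (hqd a u hu) ht0.le
      simp only [Prod.fst_add, Prod.snd_add, Prod.smul_fst, Prod.smul_snd, Prod.fst_sub,
        Prod.snd_sub, inner_add_left, inner_add_right, inner_smul_left, inner_smul_right,
        inner_sub_left, inner_sub_right, conj_trivial]
      linarith
    have h2 := hmin _ _ h1
    have e1 : (y + t • (q - y)).1 - w.1 = (y.1 - w.1) + t • (q.1 - y.1) := by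
      simp only [Prod.fst_add, Prod.smul_fst, Prod.fst_sub]; abel
    have e2 : (y + t • (q - y)).2 - w.2 = (y.2 - w.2) + t • (q.2 - y.2) := by
      simp only [Prod.snd_add, Prod.smul_snd, Prod.snd_sub]; abel
    rw [e1, e2, norm_add_smul_sq, norm_add_smul_sq] at h2
    rw [← neg_sub y.1 w.1, ← neg_sub y.2 w.2, inner_neg_right, inner_neg_right] at hs
    have h3 : 0 ≤ t * (-s + 1 / 2 * (t * N)) := by rw [hs, hN]; linarith
    have h4 := nonneg_of_mul_nonneg_right h3 ht0
    nlinarith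
  exact ⟨y, c, le_antisymm hy (by simpa using key y), key⟩

theorem exists_mem_proxExtension_add [FiniteDimensional ℝ E] {A : E → Set E} (hA : IsMonotoneOp A)
    {a₀ u₀ : E} (h₀ : u₀ ∈ A a₀) (v : E) :
    ∃ x, ∃ u ∈ proxExtension A x, x + u = v := by
  obtain ⟨⟨a, b⟩, c, hc, hsub⟩ := exists_prox_fitzpatrick hA h₀ (v, v)
  simp only at hsub
  -- the proximal point of the transposed conjugate is `(v - b, v - a)`
  set x : E := (1 / 2 : ℝ) • (a + (v - b)) with hx
  set u : E := (1 / 2 : ℝ) • (b + (v - a)) with hu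
  have hxu : x + u = v := by
    rw [hx, hu, ← smul_add, show a + (v - b) + (b + (v - a)) = (2 : ℝ) • v by
      rw [two_smul]; abel, smul_smul]
    norm_num
  refine ⟨x, u, ?_, hxu⟩
  refine mem_subdiff_of_le
    (c := 1 / 2 * c + 1 / 2 * (⟪a, v - a⟫_ℝ + ⟪b, v - b⟫_ℝ - c)
      + 1 / 8 * (‖a - (v - b)‖ ^ 2 + ‖b - (v - a)‖ ^ 2)) ?_ fun q => ?_
  · exact proxAverage_le (y := (a, b)) (z := (v - b, v - a)) hc.le
      (fenchelConj_le_of_subgradient (p := (a, b)) (g := (v - a, v - b)) hsub) rfl le_rfl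
  · refine le_proxAverage hsub
      (fun z => le_fenchelConj _ (a, b) (z.2, z.1) hc) ?_
    rintro ⟨y, y'⟩ ⟨z, z'⟩ rfl
    -- The gap between the two sides is one eighth of the sum of these two squares.
    have e1 := sq_nonneg ‖(y - z) - (a - (v - b))‖
    have e2 := sq_nonneg ‖(y' - z') - (b - (v - a))‖
    simp only [hx, hu, ← real_inner_self_eq_norm_sq, Prod.mk_add_mk, Prod.smul_mk, inner_sub_left, inner_sub_right, inner_smul_left,
      inner_smul_right, inner_add_left, inner_add_right, conj_trivial] at e1 e2 ⊢
    linarith [real_inner_comm a b, real_inner_comm a v, real_inner_comm a y, real_inner_comm a z,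
      real_inner_comm a y', real_inner_comm a z', real_inner_comm b v, real_inner_comm b y,
      real_inner_comm b z, real_inner_comm b y', real_inner_comm b z', real_inner_comm v y,
      real_inner_comm v z, real_inner_comm v y', real_inner_comm v z', real_inner_comm y z,
      real_inner_comm y' z']

/-- The easy half of Minty's theorem: in a monotone extension, two graph points with the same sum `x
+ u` coincide. -/
theorem isMaximalMonotoneOp_of_surjective {A : E → Set E} (hA : IsMonotoneOp A)
    (h : ∀ v, ∃ x, ∃ u ∈ A x, x + u = v) : IsMaximalMonotoneOp A := by
  refine ⟨hA, fun B hB hBA => funext fun x => Set.Subset.antisymm (fun u hu => ?_) (hBA x)⟩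
  obtain ⟨y, v, hv, hyv⟩ := h (x + u)
  have h1 := hB x u hu y v (hBA y hv)
  have h2 : u - v = -(x - y) := by
    rw [eq_sub_of_add_eq' hyv]; abel
  rw [h2, inner_neg_right, real_inner_self_eq_norm_sq] at h1
  have h3 : x - y = 0 := by
    rw [← norm_eq_zero]; exact pow_eq_zero_iff two_ne_zero |>.1 (by linarith [sq_nonneg ‖x - y‖])
  rw [h3, neg_zero, sub_eq_zero] at h2
  rw [sub_eq_zero.1 h3, h2]
  exact hv

theorem isMaximalMonotoneOp_proxExtension [FiniteDimensional ℝ E] {A : E → Set E}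
    (hA : IsMonotoneOp A) {a₀ u₀ : E} (h₀ : u₀ ∈ A a₀) : IsMaximalMonotoneOp (proxExtension A) :=
  isMaximalMonotoneOp_of_surjective (isMonotoneOp_proxExtension A)
    (exists_mem_proxExtension_add hA h₀)

end ProximalAverage

/-! ### Minty's theorem, interior of the domain, and sums with normal cones -/

section MaximalMonotone

open Filter Topology

variable {E : Type*} [NormedAddCommGroup E] [InnerProductSpace ℝ E]

theorem IsMaximalMonotoneOp.mem_of_forall {B : E → Set E} (hB : IsMaximalMonotoneOp B) {x v : E}
    (h : ∀ a, ∀ u ∈ B a, 0 ≤ ⟪x - a, v - u⟫_ℝ) : v ∈ B x := by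
  have key : (fun y => {w | w ∈ B y ∨ (y = x ∧ w = v)}) = B := by
    apply hB.2
    · rintro y w (hw | ⟨rfl, rfl⟩) y' w' (hw' | ⟨rfl, rfl⟩)
      · exact hB.1 y w hw y' w' hw'
      · rw [← neg_sub, ← neg_sub w', inner_neg_neg]
        exact h y w hw
      · exact h y' w' hw'
      · simp
    · exact fun y w hw => Or.inl hw
  rw [← key]
  exact Or.inr ⟨rfl, rfl⟩

theorem IsMaximalMonotoneOp.mem_of_tendsto {B : E → Set E} (hB : IsMaximalMonotoneOp B)
    {x u : ℕ → E} {x₀ u₀ : E} (hx : Tendsto x atTop (𝓝 x₀)) (hu : Tendsto u atTop (𝓝 u₀))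
    (h : ∀ n, u n ∈ B (x n)) : u₀ ∈ B x₀ :=
  hB.mem_of_forall fun a v hv => ge_of_tendsto
    ((hx.sub tendsto_const_nhds).inner (hu.sub tendsto_const_nhds))
    (Eventually.of_forall fun n => hB.1 _ _ (h n) a v hv)

theorem norm_le_norm_of_sq_le_inner {a b : E} (h : ‖a‖ ^ 2 ≤ ⟪a, b⟫_ℝ) : ‖a‖ ≤ ‖b‖ := by
  have h1 := h.trans (real_inner_le_norm a b)
  rcases (norm_nonneg a).eq_or_lt with h0 | h0
  · rw [← h0]; exact norm_nonneg b
  · rw [sq] at h1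
    exact le_of_mul_le_mul_left h1 h0

/-- The resolvents of a monotone operator are nonexpansive. -/
theorem IsMonotoneOp.norm_sub_le {B : E → Set E} (hB : IsMonotoneOp B) {x u y v : E} {c : ℝ}
    (hc : 0 ≤ c) (hu : u ∈ B x) (hv : v ∈ B y) : ‖x - y‖ ≤ ‖(x + c • u) - (y + c • v)‖ := by
  apply norm_le_norm_of_sq_le_inner
  rw [show (x + c • u) - (y + c • v) = (x - y) + c • (u - v) by rw [smul_sub]; abel,
    inner_add_right, inner_smul_right, real_inner_self_eq_norm_sq]
  linarith [mul_nonneg hc (hB x u hu y v hv)]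

/-- **Minty's theorem** in finite dimension. -/
theorem IsMaximalMonotoneOp.exists_add_smul_eq [FiniteDimensional ℝ E] {B : E → Set E}
    (hB : IsMaximalMonotoneOp B) {a₀ u₀ : E} (h₀ : u₀ ∈ B a₀) {c : ℝ} (hc : 0 < c) (v : E) :
    ∃ x, ∃ u ∈ B x, x + c • u = v := by
  set C : E → Set E := fun x => (fun u => c • u) '' B x with hC
  have hCm : IsMonotoneOp C := by
    rintro x _ ⟨u, hu, rfl⟩ y _ ⟨v, hv, rfl⟩
    simp only
    rw [← smul_sub, inner_smul_right]
    exact mul_nonneg hc.le (hB.1 x u hu y v hv)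
  obtain ⟨x, w, hw, hxw⟩ := exists_mem_proxExtension_add hCm (Set.mem_image_of_mem _ h₀) v
  -- Maximality of `C` is not needed: `w` is monotonically related to its graph, so after rescaling
  -- maximality of `B` applies.
  refine ⟨x, c⁻¹ • w, hB.mem_of_forall fun a u hu => ?_, ?_⟩
  · have h1 := isMonotoneOp_proxExtension C x w hw a (c • u)
      (isExtension_proxExtension hCm a (Set.mem_image_of_mem _ hu))
    rw [show w - c • u = c • (c⁻¹ • w - u) by rw [smul_sub, smul_inv_smul₀ hc.ne'],
      inner_smul_right] at h1
    exact nonneg_of_mul_nonneg_right h1 hc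
  · rw [smul_inv_smul₀ hc.ne', hxw]

/-- The points `a` admitting such a bound form a convex set, which therefore contains a ball around
`p`. So the family is bounded in every direction, and uniform boundedness applies. -/
theorem exists_norm_le_of_forall_inner_le [FiniteDimensional ℝ E] {ι : Type*} (u : ι → E)
    {s : Set E} {p : E} (hp : p ∈ interior (convexHull ℝ s))
    (h : ∀ a ∈ s, ∃ C, ∀ i, ⟪a - p, u i⟫_ℝ ≤ C) : ∃ C, ∀ i, ‖u i‖ ≤ C := by
  set S : Set E := {a | ∃ C, ∀ i, ⟪a - p, u i⟫_ℝ ≤ C} with hS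
  have hSc : Convex ℝ S := by
    rintro a ⟨C, hC⟩ b ⟨D, hD⟩ t r ht hr htr
    refine ⟨t * C + r * D, fun i => ?_⟩
    rw [show t • a + r • b - p = t • (a - p) + r • (b - p) by
      rw [smul_sub, smul_sub, sub_add_sub_comm, ← add_smul, htr, one_smul],
      inner_add_left, inner_smul_left, inner_smul_left]
    exact add_le_add (mul_le_mul_of_nonneg_left (hC i) ht) (mul_le_mul_of_nonneg_left (hD i) hr)
  have hsub : convexHull ℝ s ⊆ S := convexHull_min h hSc
  obtain ⟨ε, hε, hball⟩ := Metric.mem_nhds_iff.1 (mem_interior_iff_mem_nhds.1 hp)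
  have key : ∀ v : E, ∃ C, ∀ i, ⟪v, u i⟫_ℝ ≤ C := by
    intro v
    obtain ⟨t, ht⟩ : ∃ t : ℝ, t = ε / (2 * (‖v‖ + 1)) := ⟨_, rfl⟩
    have hv := norm_nonneg v
    have ht0 : 0 < t := by rw [ht]; positivity
    have htv : t * ‖v‖ < ε := by
      rw [ht, div_mul_eq_mul_div, div_lt_iff₀ (by positivity)]
      nlinarith
    obtain ⟨C, hC⟩ := hsub (hball (show p + t • v ∈ Metric.ball p ε by
      rw [mem_ball_iff_norm, add_sub_cancel_left, norm_smul, Real.norm_of_nonneg ht0.le]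
      exact htv))
    refine ⟨C / t, fun i => ?_⟩
    rw [le_div_iff₀ ht0, mul_comm]
    simpa [inner_smul_left] using hC i
  obtain ⟨C, hC⟩ := banach_steinhaus (g := fun i => innerSL ℝ (u i)) fun v => by
    obtain ⟨C, hC⟩ := key v
    obtain ⟨D, hD⟩ := key (-v)
    refine ⟨max C D, fun i => ?_⟩
    rw [innerSL_apply_apply, real_inner_comm, Real.norm_eq_abs, abs_le']
    refine ⟨(hC i).trans (le_max_left _ _), ?_⟩
    rw [← inner_neg_left]
    exact (hD i).trans (le_max_right _ _)
  exact ⟨C, fun i => by simpa using hC i⟩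

/-- In finite dimension, the domain of a maximal monotone operator contains the interior of its
convex hull. -/
theorem IsMaximalMonotoneOp.interior_convexHull_subset_opDom [FiniteDimensional ℝ E]
    {B : E → Set E} (hB : IsMaximalMonotoneOp B) :
    interior (convexHull ℝ (opDom B)) ⊆ opDom B := by
  intro p hp
  obtain ⟨a₀, u₀, h₀⟩ := convexHull_nonempty_iff.1 ⟨p, interior_subset hp⟩
  have hpos : ∀ n : ℕ, 0 < 1 / ((n : ℝ) + 1) := fun n => Nat.one_div_pos_of_nat
  have hle : ∀ n : ℕ, 1 / ((n : ℝ) + 1) ≤ 1 := fun n => by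
    rw [div_le_one (by positivity)]; linarith [n.cast_nonneg (α := ℝ)]
  choose x u hu hxu using fun n : ℕ => hB.exists_add_smul_eq h₀ (hpos n) p
  have hx : ∀ n, p - x n = (1 / ((n : ℝ) + 1)) • u n := fun n => by
    rw [← hxu n, add_sub_cancel_left]
  have hbdd : ∃ C, ∀ n, ‖u n‖ ≤ C := by
    refine exists_norm_le_of_forall_inner_le u hp ?_
    rintro a ⟨v, hv⟩
    -- Split `a - p` as `(a - x n) - (p - x n)`: monotonicity replaces `u n` by `v` in the first
    -- term, and the second contributes a multiple of `‖u n‖ ^ 2` with favourable sign.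
    refine ⟨(‖a - p‖ + ‖v‖) * ‖v‖, fun n => ?_⟩
    have h1 := hB.1 _ _ (hu n) a v hv
    have h2 := hB.1.norm_sub_le (hpos n).le hv (hu n)
    rw [hxu] at h2
    have h3 : ‖a - x n‖ ≤ ‖a - p‖ + ‖v‖ := by
      refine h2.trans ?_
      rw [add_sub_right_comm]
      refine (norm_add_le _ _).trans (add_le_add_right ?_ _)
      rw [norm_smul, Real.norm_of_nonneg (hpos n).le]
      exact mul_le_of_le_one_left (norm_nonneg v) (hle n)
    have h4 : 0 ≤ ⟪p - x n, u n⟫_ℝ := by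
      rw [hx, inner_smul_left, real_inner_self_eq_norm_sq]
      exact mul_nonneg (hpos n).le (sq_nonneg _)
    have h5 := (real_inner_le_norm (a - x n) v).trans
      (mul_le_mul_of_nonneg_right h3 (norm_nonneg v))
    simp only [inner_sub_left, inner_sub_right] at h1 h4 h5 ⊢
    linarith
  obtain ⟨C, hC⟩ := hbdd
  obtain ⟨w, -, φ, hφ, hw⟩ := (isCompact_closedBall (0 : E) C).tendsto_subseq
    (x := u) fun n => by simpa using hC n
  refine ⟨w, hB.mem_of_tendsto (x := x ∘ φ) ?_ hw fun n => hu (φ n)⟩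
  have hlim : Tendsto (fun n => p - (1 / (((φ n : ℕ) : ℝ) + 1)) • u (φ n)) atTop
      (𝓝 (p - (0 : ℝ) • w)) :=
    tendsto_const_nhds.sub
      ((tendsto_one_div_add_atTop_nhds_zero_nat.comp hφ.tendsto_atTop).smul hw)
  rw [zero_smul, sub_zero] at hlim
  refine hlim.congr fun n => ?_
  rw [← hx, sub_sub_cancel, Function.comp_apply]

theorem exists_metric_projection [FiniteDimensional ℝ E] {D : Set E} (hDc : IsClosed D)
    (hDv : Convex ℝ D) (hDn : D.Nonempty) (x : E) :
    ∃ p ∈ D, ∀ d ∈ D, ⟪x - p, d - p⟫_ℝ ≤ 0 := by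
  obtain ⟨p, hp, h⟩ := exists_norm_eq_iInf_of_complete_convex hDn hDc.isComplete hDv x
  exact ⟨p, hp, (norm_eq_iInf_iff_real_inner_le_zero hDv hp).1 h⟩

/-- Yosida regularisation of the normal cone in the inclusion `z ∈ x + B x + N_D x`. -/
theorem IsMaximalMonotoneOp.exists_penalized_solution [FiniteDimensional ℝ E] {B : E → Set E}
    (hB : IsMaximalMonotoneOp B) {a₀ u₀ : E} (h₀ : u₀ ∈ B a₀) {D : Set E} {P : E → E}
    (hPD : ∀ x, P x ∈ D) (hP : ∀ x, ∀ d ∈ D, ⟪x - P x, d - P x⟫_ℝ ≤ 0) (z : E) {r : ℝ}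
    (hr : 0 ≤ r) : ∃ x, ∃ u ∈ B x, x + u + r • (x - P x) = z := by
  have hr1 : 0 < 1 + r := by linarith
  have hPn : ∀ x y, ‖P x - P y‖ ≤ ‖x - y‖ := by
    intro x y
    apply norm_le_norm_of_sq_le_inner
    have h1 := hP x _ (hPD y)
    have h2 := hP y _ (hPD x)
    rw [← real_inner_self_eq_norm_sq]
    simp only [inner_sub_left, inner_sub_right] at h1 h2 ⊢
    linarith [real_inner_comm x (P x), real_inner_comm x (P y), real_inner_comm y (P x),
      real_inner_comm y (P y)]
  have hc : 0 < (1 + r)⁻¹ := inv_pos.2 hr1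
  choose J j hj hJ using hB.exists_add_smul_eq h₀ hc
  have hJn : ∀ v w, ‖J v - J w‖ ≤ ‖v - w‖ := fun v w => by
    simpa only [hJ] using hB.1.norm_sub_le hc.le (hj v) (hj w)
  -- Dividing the equation by `1 + r` turns it into a fixed-point problem; the nonexpansive `J` and
  -- `P` make `T` a contraction of ratio `r / (1 + r)`.
  set T : E → E := fun x => J ((1 + r)⁻¹ • (z + r • P x)) with hT
  have hTc : ContractingWith (NNReal.mk (r / (1 + r)) (div_nonneg hr hr1.le)) T := by
    refine ⟨?_, LipschitzWith.of_dist_le_mul fun x y => ?_⟩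
    · rw [← NNReal.coe_lt_coe]
      exact (div_lt_one hr1).2 (by linarith)
    · rw [dist_eq_norm, dist_eq_norm]
      refine (hJn _ _).trans ?_
      rw [← smul_sub, add_sub_add_left_eq_sub, ← smul_sub, smul_smul, norm_smul,
        Real.norm_of_nonneg (by positivity), NNReal.coe_mk, div_eq_inv_mul]
      exact mul_le_mul_of_nonneg_left (hPn x y) (by positivity)
  set x := hTc.fixedPoint T
  have hx : J ((1 + r)⁻¹ • (z + r • P x)) = x := hTc.fixedPoint_isFixedPt
  have h1 := hJ ((1 + r)⁻¹ • (z + r • P x))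
  have h2 := hj ((1 + r)⁻¹ • (z + r • P x))
  rw [hx] at h1 h2
  refine ⟨x, _, h2, ?_⟩
  have h3 := congrArg (fun v => (1 + r) • v) h1
  rw [smul_add, smul_inv_smul₀ hr1.ne', smul_inv_smul₀ hr1.ne', add_smul, one_smul] at h3
  rw [smul_sub, ← add_sub_assoc, add_right_comm, h3, add_sub_cancel_right]

/-- The sum of a maximal monotone operator and of a normal cone operator has full resolvent range,
under an interior point condition. -/
theorem IsMaximalMonotoneOp.exists_add_normalConeOp_eq [FiniteDimensional ℝ E] {B : E → Set E}
    (hB : IsMaximalMonotoneOp B) (h0 : (0 : E) ∈ opDom B) {D : Set E} (hDc : IsClosed D)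
    (hDv : Convex ℝ D) (hD0 : (0 : E) ∈ interior D) (z : E) :
    ∃ x, ∃ u ∈ B x, ∃ w ∈ normalConeOp D x, x + u + w = z := by
  obtain ⟨b, hb⟩ := h0
  choose P hPD hP using exists_metric_projection hDc hDv ⟨0, interior_subset hD0⟩
  choose x u hu hxu using fun n : ℕ =>
    hB.exists_penalized_solution hb hPD hP z (Nat.cast_nonneg n : (0 : ℝ) ≤ n)
  set w : ℕ → E := fun n => (n : ℝ) • (x n - P (x n)) with hw
  have hD0' : (0 : E) ∈ D := interior_subset hD0
  obtain ⟨ε, hε, hball⟩ := Metric.mem_nhds_iff.1 (mem_interior_iff_mem_nhds.1 hD0)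
  -- `w n` is, up to an error in the right direction, normal to `D` at `x n`
  have hwD : ∀ n, ∀ d ∈ D, ⟪d - x n, w n⟫_ℝ ≤ 0 := by
    intro n d hd
    have h1 := hP (x n) d hd
    have h2 := real_inner_self_nonneg (x := x n - P (x n))
    rw [hw]
    simp only [inner_smul_right]
    refine mul_nonpos_of_nonneg_of_nonpos n.cast_nonneg ?_
    rw [real_inner_comm, show d - x n = (d - P (x n)) - (x n - P (x n)) by abel, inner_sub_right]
    linarith
  have hmon : ∀ n, ‖x n‖ ^ 2 + ⟪x n, w n⟫_ℝ ≤ ⟪x n, z - b⟫_ℝ := by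
    intro n
    have h1 := hB.1 _ _ (hu n) 0 b hb
    have h2 : u n = z - x n - w n := by rw [← hxu n]; simp only [hw]; abel
    rw [h2, sub_zero] at h1
    rw [← real_inner_self_eq_norm_sq]
    simp only [inner_sub_right] at h1 ⊢
    linarith
  have hxb : ∀ n, ‖x n‖ ≤ ‖z - b‖ := by
    intro n
    apply norm_le_norm_of_sq_le_inner
    have h1 := hwD n 0 hD0'
    rw [zero_sub, inner_neg_left] at h1
    linarith [hmon n]
  have hwb : ∀ n, ‖w n‖ ≤ 2 * (‖z - b‖ ^ 2 / ε) := by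
    intro n
    rcases (norm_nonneg (w n)).eq_or_lt with h0 | h0
    · rw [← h0]; positivity
    -- Testing with the point of `D` at distance `ε / 2` from `0` along `w n` gives `ε / 2 * ‖w n‖ ≤
    -- ⟪x n, w n⟫`, which `hmon` bounds.
    have h1 := hwD n ((ε / 2 / ‖w n‖) • w n) (hball (by
      rw [mem_ball_zero_iff, norm_smul, Real.norm_of_nonneg (by positivity),
        div_mul_cancel₀ _ h0.ne']
      linarith))
    rw [inner_sub_left, inner_smul_left, real_inner_self_eq_norm_sq, conj_trivial,
      show ε / 2 / ‖w n‖ * ‖w n‖ ^ 2 = ε / 2 * ‖w n‖ by field_simp] at h1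
    have h2 := (real_inner_le_norm (x n) (z - b)).trans
      (mul_le_mul_of_nonneg_right (hxb n) (norm_nonneg _))
    have h3 := hmon n
    rw [← mul_div_assoc, le_div_iff₀ hε]
    nlinarith [sq_nonneg ‖x n‖]
  obtain ⟨⟨x₀, w₀⟩, -, φ, hφ, hlim⟩ :=
    ((isCompact_closedBall (0 : E) ‖z - b‖).prod
      (isCompact_closedBall (0 : E) (2 * (‖z - b‖ ^ 2 / ε)))).tendsto_subseq
      (x := fun n => (x n, w n)) fun n => ⟨by simpa using hxb n, by simpa using hwb n⟩
  have hx₀ : Tendsto (fun n => x (φ n)) atTop (𝓝 x₀) := (Prod.tendsto_iff _ _).1 hlim |>.1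
  have hw₀ : Tendsto (fun n => w (φ n)) atTop (𝓝 w₀) := (Prod.tendsto_iff _ _).1 hlim |>.2
  refine ⟨x₀, z - x₀ - w₀, ?_, w₀, ⟨?_, fun d hd => ?_⟩, by abel⟩
  · refine hB.mem_of_tendsto hx₀ ((tendsto_const_nhds.sub hx₀).sub hw₀) fun n => ?_
    convert hu (φ n) using 1
    rw [← hxu (φ n)]; simp only [hw]; abel
  · have hinv : Tendsto (fun n => ((φ n : ℕ) : ℝ)⁻¹) atTop (𝓝 0) :=
      tendsto_inv_atTop_nhds_zero_nat.comp hφ.tendsto_atTop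
    -- Boundedness of `w` forces `x n - P (x n) = w n / n` to vanish along the subsequence, so the
    -- limit lies in `D`.
    have hP₀ := hx₀.sub (hinv.smul hw₀)
    rw [zero_smul, sub_zero] at hP₀
    refine hDc.mem_of_tendsto hP₀ ?_
    filter_upwards [hφ.tendsto_atTop.eventually_gt_atTop 0] with n hn
    have hn' : ((φ n : ℕ) : ℝ) ≠ 0 := by exact_mod_cast hn.ne'
    simp only [hw]
    rw [inv_smul_smul₀ hn', sub_sub_cancel]
    exact hPD _
  · exact le_of_tendsto ((tendsto_const_nhds.sub hx₀).inner hw₀)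
      (Eventually.of_forall fun n => hwD (φ n) d hd)

end MaximalMonotone

/-! ### Relative interiors as interiors in a subspace -/

section RelativeInterior

variable {X : Type*} [NormedAddCommGroup X] [InnerProductSpace ℝ X]

theorem intrinsicInterior_eq_image_of_affineSpan_eq {s : Set X} {Y : Submodule ℝ X}
    (h : affineSpan ℝ s = Y.toAffineSubspace) :
    intrinsicInterior ℝ s = ((↑) : Y → X) '' interior {y : Y | (y : X) ∈ s} := by
  have key : ∀ S : AffineSubspace ℝ X, affineSpan ℝ s = S →
      intrinsicInterior ℝ s = ((↑) : S → X) '' interior (((↑) : S → X) ⁻¹' s) := by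
    rintro S rfl
    rfl
  exact key _ h

theorem affineSpan_eq_of_zero_mem {s : Set X} (h : (0 : X) ∈ affineSpan ℝ s) :
    affineSpan ℝ s = (Submodule.span ℝ s).toAffineSubspace := by
  refine le_antisymm affineSpan_le_toAffineSubspace_span fun x hx => ?_
  have hle : Submodule.span ℝ s ≤ (affineSpan ℝ s).direction := by
    refine Submodule.span_le.2 fun a ha => ?_
    simpa using AffineSubspace.vsub_mem_direction (subset_affineSpan ℝ s ha) h
  simpa using AffineSubspace.vadd_mem_of_mem_direction (hle hx) h

theorem affineSpan_closure_eq [FiniteDimensional ℝ X] (s : Set X) :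
    affineSpan ℝ (closure s) = affineSpan ℝ s := by
  refine le_antisymm (affineSpan_le.2 ?_) (affineSpan_mono ℝ subset_closure)
  exact closure_minimal (subset_affineSpan ℝ s) (AffineSubspace.closed_of_finiteDimensional _)

theorem setOf_coe_mem_convexHull {s : Set X} {Y : Submodule ℝ X} (h : s ⊆ Y) :
    {y : Y | (y : X) ∈ convexHull ℝ s} = convexHull ℝ {y : Y | (y : X) ∈ s} := by
  have h1 : (Y.subtype : Y → X) '' {y : Y | (y : X) ∈ s} = s := by
    ext x
    exact ⟨by rintro ⟨y, hy, rfl⟩; exact hy, fun hx => ⟨⟨x, h hx⟩, hx, rfl⟩⟩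
  have h2 := Y.subtype.image_convexHull {y : Y | (y : X) ∈ s}
  rw [h1] at h2
  ext y
  rw [Set.mem_ofPred_eq, ← h2]
  exact ⟨fun ⟨y', hy', e⟩ => Subtype.ext e ▸ hy', fun hy => ⟨y, hy, rfl⟩⟩

theorem setOf_coe_mem_closure {s : Set X} {Y : Submodule ℝ X} (h : s ⊆ Y)
    (hY : IsClosed (Y : Set X)) :
    {y : Y | (y : X) ∈ closure s} = closure {y : Y | (y : X) ∈ s} := by
  have h1 : (Subtype.val : Y → X) '' {y : Y | (y : X) ∈ s} = s := by
    ext x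
    exact ⟨by rintro ⟨y, hy, rfl⟩; exact hy, fun hx => ⟨⟨x, h hx⟩, hx, rfl⟩⟩
  have h2 : closure ((Subtype.val : Y → X) '' {y : Y | (y : X) ∈ s})
      = Subtype.val '' closure {y : Y | (y : X) ∈ s} :=
    hY.isClosedEmbedding_subtypeVal.closure_image_eq _
  rw [h1] at h2
  ext y
  rw [Set.mem_ofPred_eq, h2]
  exact ⟨fun ⟨y', hy', e⟩ => Subtype.ext e ▸ hy', fun hy => ⟨y, hy, rfl⟩⟩

end RelativeInterior

/-! ### Compression to `Y` and lifting back to `X` -/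

section Lift

variable {X : Type*} [NormedAddCommGroup X] [InnerProductSpace ℝ X] {Y : Submodule ℝ X}

theorem inner_eq_inner_coe_of_eq_starProjection [Y.HasOrthogonalProjection] {Q : X →ₗ[ℝ] Y}
    (hQ : ∀ x, (Q x : X) = Y.starProjection x) (x : X) (y : Y) : ⟪Q x, y⟫_ℝ = ⟪x, (y : X)⟫_ℝ := by
  rw [Submodule.coe_inner, hQ, ← sub_eq_zero, ← inner_sub_left, ← neg_sub, inner_neg_left,
    Submodule.starProjection_inner_eq_zero x y y.2, neg_zero]

theorem isMonotoneOp_compressOp [Y.HasOrthogonalProjection] {Q : X →ₗ[ℝ] Y}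
    (hQ : ∀ x, (Q x : X) = Y.starProjection x) {A : X → Set X} (hA : IsMonotoneOp A) :
    IsMonotoneOp (compressOp Q A) := by
  rintro x _ ⟨u, hu, rfl⟩ y _ ⟨v, hv, rfl⟩
  rw [← map_sub, real_inner_comm, inner_eq_inner_coe_of_eq_starProjection hQ, real_inner_comm]
  exact hA x u hu y v hv

theorem opDom_compressOp (Q : X →ₗ[ℝ] Y) (A : X → Set X) :
    opDom (compressOp Q A) = {y : Y | (y : X) ∈ opDom A} := by
  ext y
  exact Set.image_nonempty

theorem IsExtension.opDom_subset {E F : Type*} {A B : E → Set F} (h : IsExtension B A) :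
    opDom A ⊆ opDom B := fun x hx => hx.mono (h x)

theorem mem_normalConeOp_add_of_orthogonal {D : Set X} (hDY : D ⊆ Y) {x : Y} {w : Y}
    (hw : w ∈ normalConeOp {y : Y | (y : X) ∈ D} x) {v : X} (hv : ∀ y ∈ Y, ⟪y, v⟫_ℝ = 0) :
    (w : X) + v ∈ normalConeOp D (x : X) := by
  refine ⟨hw.1, fun d hd => ?_⟩
  rw [inner_add_right, hv _ (Y.sub_mem (hDY hd) x.2), add_zero]
  exact hw.2 ⟨d, hDY hd⟩ hd

variable [FiniteDimensional ℝ X]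

theorem adjoint_eq_coe {Q : X →ₗ[ℝ] Y} (hQ : ∀ x, (Q x : X) = Y.starProjection x) (y : Y) :
    LinearMap.adjoint Q y = (y : X) := by
  refine ext_inner_left ℝ fun x => ?_
  rw [LinearMap.adjoint_inner_right, inner_eq_inner_coe_of_eq_starProjection hQ]

theorem apply_coe_eq {Q : X →ₗ[ℝ] Y} (hQ : ∀ x, (Q x : X) = Y.starProjection x) (y : Y) :
    Q (y : X) = y :=
  Subtype.ext (by rw [hQ, Submodule.starProjection_eq_self_iff.2 y.2])

theorem inner_sub_apply_eq_zero {Q : X →ₗ[ℝ] Y} (hQ : ∀ x, (Q x : X) = Y.starProjection x) (v : X) :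
    ∀ y ∈ Y, ⟪y, v - Q v⟫_ℝ = 0 := fun y hy => by
  rw [real_inner_comm, hQ, Submodule.starProjection_inner_eq_zero v y hy]

theorem isMonotoneOp_liftOp {Q : X →ₗ[ℝ] Y} {B : Y → Set Y} (hB : IsMonotoneOp B) (D : Set X) :
    IsMonotoneOp (liftOp Q B D) := by
  rintro x _ ⟨_, ⟨u, hu, rfl⟩, m, ⟨hx, hm⟩, rfl⟩ y _ ⟨_, ⟨v, hv, rfl⟩, n, ⟨hy, hn⟩, rfl⟩
  have h1 := hB _ u hu _ v hv
  have h2 := hm y hy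
  have h3 := hn x hx
  simp only
  rw [add_sub_add_comm, inner_add_right, ← map_sub, LinearMap.adjoint_inner_right, map_sub]
  simp only [inner_sub_left, inner_sub_right] at h1 h2 h3 ⊢
  linarith

theorem isExtension_liftOp {Q : X →ₗ[ℝ] Y} (hQ : ∀ x, (Q x : X) = Y.starProjection x)
    {A : X → Set X} {B : Y → Set Y} (hBA : IsExtension B (compressOp Q A)) {D : Set X}
    (hAD : opDom A ⊆ D) (hDY : D ⊆ Y) : IsExtension (liftOp Q B D) A := by
  intro x u hu
  have hxD : x ∈ D := hAD ⟨u, hu⟩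
  refine ⟨(Q u : X), ⟨Q u, ?_, adjoint_eq_coe hQ _⟩, u - Q u, ⟨hxD, fun d hd => ?_⟩,
    add_sub_cancel _ _⟩
  · have hQx : Q x = ⟨x, hDY hxD⟩ := apply_coe_eq hQ ⟨x, hDY hxD⟩
    rw [hQx]
    exact hBA ⟨x, hDY hxD⟩ ⟨u, hu, rfl⟩
  · exact (inner_sub_apply_eq_zero hQ u _ (Y.sub_mem (hDY hd) (hDY hxD))).le

theorem isMaximalMonotoneOp_liftOp {Q : X →ₗ[ℝ] Y} (hQ : ∀ x, (Q x : X) = Y.starProjection x)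
    {B : Y → Set Y} (hB : IsMaximalMonotoneOp B) (hB0 : (0 : Y) ∈ opDom B) {D : Set X}
    (hDY : D ⊆ Y) (hDc : IsClosed D) (hDv : Convex ℝ D)
    (hD0 : (0 : Y) ∈ interior {y : Y | (y : X) ∈ D}) : IsMaximalMonotoneOp (liftOp Q B D) := by
  refine isMaximalMonotoneOp_of_surjective (isMonotoneOp_liftOp hB.1 D) fun z => ?_
  obtain ⟨x, u, hu, w, hw, hxz⟩ := hB.exists_add_normalConeOp_eq hB0
    (hDc.preimage continuous_subtype_val) (hDv.linear_preimage Y.subtype) hD0 (Q z)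
  refine ⟨x, u + (w + (z - Q z)), ⟨u, ⟨u, ?_, adjoint_eq_coe hQ u⟩, _,
    mem_normalConeOp_add_of_orthogonal hDY hw (inner_sub_apply_eq_zero hQ z), rfl⟩, ?_⟩
  · rw [apply_coe_eq hQ]
    exact hu
  · rw [← hxz]
    push_cast
    abel

/-- A convex set with nonempty interior lies in the closure of that interior, and over the interior
of `D` in `Y` the zero normal vector suffices. -/
theorem closure_opDom_liftOp {Q : X →ₗ[ℝ] Y} (hQ : ∀ x, (Q x : X) = Y.starProjection x)
    {B : Y → Set Y} {D : Set X} (hDY : D ⊆ Y) (hDc : IsClosed D) (hDv : Convex ℝ D)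
    (hD0 : (0 : Y) ∈ interior {y : Y | (y : X) ∈ D})
    (hDB : interior {y : Y | (y : X) ∈ D} ⊆ opDom B) : closure (opDom (liftOp Q B D)) = D := by
  refine Set.Subset.antisymm (closure_minimal ?_ hDc) fun x hx => ?_
  · rintro x ⟨_, _, _, n, hn, _⟩
    exact hn.1
  · have hv : Convex ℝ {y : Y | (y : X) ∈ D} := hDv.linear_preimage Y.subtype
    have h1 := hv.closure_interior_eq_closure_of_nonempty_interior ⟨0, hD0⟩
    have h2 : (⟨x, hDY hx⟩ : Y) ∈ closure (interior {y : Y | (y : X) ∈ D}) :=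
      h1 ▸ subset_closure hx
    refine map_mem_closure continuous_subtype_val h2 fun y hy => ?_
    obtain ⟨u, hu⟩ := hDB hy
    have hyD : y ∈ {y : Y | (y : X) ∈ D} := interior_subset hy
    refine ⟨LinearMap.adjoint Q u + 0, Set.add_mem_add ⟨u, ?_, rfl⟩
      ⟨hyD, fun d _ => by simp⟩⟩
    rw [apply_coe_eq hQ]
    exact hu

end Lift

theorem theorem2p15 {X : Type*} [NormedAddCommGroup X] [InnerProductSpace ℝ X]
    [FiniteDimensional ℝ X]
    (A : X → Set X) (hA : IsMonotoneOp A)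
    (h0 : (0 : X) ∈ intrinsicInterior ℝ (convexHull ℝ (opDom A)))
    (Y : Submodule ℝ X) (hY : Y = Submodule.span ℝ (opDom A))
    (P : X →ₗ[ℝ] X) (hP : P = Y.starProjection.toLinearMap)
    (Q : X →ₗ[ℝ] Y) (hQ : ∀ x, (Q x : X) = P x)
    (D : Set X) (hD : D = closure (convexHull ℝ (opDom A))) :
    -- the accompanying facts on `D`, `Y`, `P` and `Q`
    (intrinsicInterior ℝ D = intrinsicInterior ℝ (convexHull ℝ (opDom A)) ∧
      (0 : Y) ∈ interior {y : Y | (y : X) ∈ D} ∧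
      (affineSpan ℝ (opDom A) : Set X) = (Y : Set X) ∧
      IsClosed (Y : Set X) ∧
      LinearMap.adjoint P = P ∧
      ∀ y : Y, LinearMap.adjoint Q y = (y : X)) ∧
    -- the composition `PA` is monotone on `Y`
    IsMonotoneOp (compressOp Q A) ∧
    -- the proximal average extension of `PA` is an admissible choice of `B` below
    (IsMaximalMonotoneOp (proxExtension (compressOp Q A)) ∧
      IsExtension (proxExtension (compressOp Q A)) (compressOp Q A)) ∧
    ∀ B : Y → Set Y, IsMaximalMonotoneOp B → IsExtension B (compressOp Q A) →
      IsMaximalMonotoneOp (liftOp Q B D) ∧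
      IsExtension (liftOp Q B D) A ∧
      closure (opDom (liftOp Q B D)) = D := by
  subst hP
  replace hQ : ∀ x, (Q x : X) = Y.starProjection x := hQ
  set S : Set X := convexHull ℝ (opDom A) with hS
  have haff : affineSpan ℝ (opDom A) = Y.toAffineSubspace := by
    rw [hY]
    refine affineSpan_eq_of_zero_mem ?_
    rw [← affineSpan_convexHull]
    exact subset_affineSpan ℝ _ (intrinsicInterior_subset h0)
  have hAY : opDom A ⊆ Y := hY ▸ Submodule.subset_span
  have hSY : S ⊆ Y := convexHull_min hAY Y.convex
  have hYc : IsClosed (Y : Set X) := Y.closed_of_finiteDimensional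
  have hDY : D ⊆ Y := hD ▸ closure_minimal hSY hYc
  have hDc : IsClosed D := hD ▸ isClosed_closure
  have hDv : Convex ℝ D := hD ▸ (convex_convexHull ℝ _).closure
  have hAD : opDom A ⊆ D := hD ▸ (subset_convexHull ℝ _).trans subset_closure
  have hSaff : affineSpan ℝ S = Y.toAffineSubspace := by rw [hS, affineSpan_convexHull, haff]
  have hDaff : affineSpan ℝ D = Y.toAffineSubspace := by rw [hD, affineSpan_closure_eq, hSaff]
  have hSint := intrinsicInterior_eq_image_of_affineSpan_eq hSaff
  have h0S : (0 : Y) ∈ interior {y : Y | (y : X) ∈ S} := by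
    rw [hSint] at h0
    obtain ⟨y, hy, hy0⟩ := h0
    rwa [show y = 0 from Subtype.ext hy0] at hy
  have hSv : Convex ℝ {y : Y | (y : X) ∈ S} := (convex_convexHull ℝ _).linear_preimage Y.subtype
  -- Closure adds no interior to a convex set that already has some; this gives `ri D = ri S` and
  -- places the interior of `D` in `dom B`.
  have hint : interior {y : Y | (y : X) ∈ D} = interior {y : Y | (y : X) ∈ S} := by
    rw [hD, setOf_coe_mem_closure hSY hYc,
      hSv.interior_closure_eq_interior_of_nonempty_interior ⟨0, h0S⟩]
  have h0D : (0 : Y) ∈ interior {y : Y | (y : X) ∈ D} := hint ▸ h0S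
  have hPA := isMonotoneOp_compressOp hQ hA
  obtain ⟨a, u, hu⟩ := convexHull_nonempty_iff.1 ⟨0, intrinsicInterior_subset h0⟩
  have huPA : Q u ∈ compressOp Q A ⟨a, hAY ⟨u, hu⟩⟩ := ⟨u, hu, rfl⟩
  refine ⟨⟨?_, h0D, ?_, hYc, ?_, adjoint_eq_coe hQ⟩, hPA,
    ⟨isMaximalMonotoneOp_proxExtension hPA huPA, isExtension_proxExtension hPA⟩,
    fun B hB hBA => ?_⟩
  · rw [hSint, intrinsicInterior_eq_image_of_affineSpan_eq hDaff, hint]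
  · rw [haff]; rfl
  · exact LinearMap.isSelfAdjoint_iff'.1
      ((LinearMap.isSymmetric_iff_isSelfAdjoint _).1 Y.starProjection_isSymmetric)
  · have hDB : interior {y : Y | (y : X) ∈ D} ⊆ opDom B := by
      rw [hint, hS, setOf_coe_mem_convexHull hAY, ← opDom_compressOp Q A]
      exact (interior_mono (convexHull_mono hBA.opDom_subset)).trans
        hB.interior_convexHull_subset_opDom
    exact ⟨isMaximalMonotoneOp_liftOp hQ hB (hDB h0D) hDY hDc hDv h0D,
      isExtension_liftOp hQ hBA hAD hDY, closure_opDom_liftOp hQ hDY hDc hDv h0D hDB⟩
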